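/- All rings are commutative and Noetherian. A local ring is Gorenstein if it has finite injective dimension as a module over itself. If $R$ is a Cohen–Macaulay local ring with residue field $k$, a canonical module of $R$ is a maximal Cohen–Macaulay $R$-module (nonzero, finitely generated, of depth $\dim R$) of Cohen–Macaulay type one and of finite injective dimension. A Cohen–Macaulay local ring $R$ of Krull dimension at most $1$ with residue field $k$ is called weakly almost Gorenstein if it has a canonical module $\omega$ and there is an exact sequence of $R$-modules $R\to\omega\to k^{\oplus n}\to 0$ for some integer $n\ge 0$ (the map $R\to\omega$ need not be injective). Let $(S,\mathfrak{n})$ be a Noetherian local ring and let $I\subseteq\mathfrak{n}^2$ be an $\mathfrak{n}$-primary ideal of $S$ such that $S/I$ is Gorenstein. Then for every ideal $J$ of $S$ with $\mathfrak{n}I\subseteq J\subseteq I$, the ring $S/J$ is weakly almost Gorenstein. -/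

import Mathlib

open CategoryTheory

universe u

namespace LocalAlgebra

section LocalRing

variable (R : Type u) [CommRing R] [IsLocalRing R]

/-- The depth of a module over a local ring: the supremum of the lengths of the `M`-regular
sequences consisting of elements of the maximal ideal (the empty sequence is allowed). -/
noncomputable def depth (M : Type u) [AddCommGroup M] [Module R M] : ℕ∞ :=
  ⨆ (rs : List R) (_ : ∀ r ∈ rs, r ∈ IsLocalRing.maximalIdeal R)
    (_ : RingTheory.Sequence.IsRegular M rs), (rs.length : ℕ∞)

/-- The dimension of `Ext^i_R(k, M)` over the residue field `k` of `R` (the `i`-th Bass number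
of `M` at the maximal ideal). Since `Ext^i_R(k, M)` is annihilated by the maximal ideal, this
dimension is its length as an `R`-module. -/
noncomputable def bassNumber (M : Type u) [AddCommGroup M] [Module R M] (i : ℕ) : ℕ∞ :=
  Module.length R
    (Abelian.Ext (ModuleCat.of R (IsLocalRing.ResidueField R)) (ModuleCat.of R M) i)

/-- A Noetherian local ring is Cohen-Macaulay if its depth equals its Krull dimension. -/
structure IsCohenMacaulay : Prop where
  isNoetherianRing : IsNoetherianRing R
  depth_eq : (depth R R : WithBot ℕ∞) = ringKrullDim R

/-- A module over a Cohen-Macaulay local ring `R` is a canonical module if it is a maximal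
Cohen-Macaulay `R`-module (nonzero, finitely generated, of depth `dim R`), of
Cohen-Macaulay type one and of finite injective dimension. -/
structure IsCanonicalModule (M : Type u) [AddCommGroup M] [Module R M] : Prop where
  finite : Module.Finite R M
  nontrivial : Nontrivial M
  depth_eq : (depth R M : WithBot ℕ∞) = ringKrullDim R
  type_eq_one : ∃ t : ℕ, depth R M = t ∧ bassNumber R M t = 1
  injectiveDimension_finite : ∃ m : ℕ, HasInjectiveDimensionLE (ModuleCat.of R M) m

end LocalRing

/-- Gorenstein local rings: Noetherian local rings of finite injective dimension as a module
over themselves. -/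
structure IsGorensteinLocal (R : Type u) [CommRing R] : Prop extends IsLocalRing R where
  isNoetherianRing : IsNoetherianRing R
  injectiveDimension_finite : ∃ m : ℕ, HasInjectiveDimensionLE (ModuleCat.of R R) m

/-- Weakly almost Gorenstein rings: Cohen-Macaulay local rings `R` of Krull dimension at most
one which have a canonical module `ω` and, for some `n`, an exact sequence
`R → ω → k ^ n → 0`, where `k` is the residue field. -/
structure IsWeaklyAlmostGorenstein (R : Type u) [CommRing R] : Prop extends IsLocalRing R where
  isCohenMacaulay : IsCohenMacaulay R
  ringKrullDim_le_one : ringKrullDim R ≤ 1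
  exists_exact : ∃ (ω : Type u) (_ : AddCommGroup ω) (_ : Module R ω),
    IsCanonicalModule R ω ∧
      ∃ (n : ℕ) (f : R →ₗ[R] ω) (g : ω →ₗ[R] (Fin n → IsLocalRing.ResidueField R)),
        Function.Exact f g ∧ Function.Surjective g

end LocalAlgebra

/-! Put `R = S/J`, an Artinian local ring with maximal ideal `m`, and let `I` also denote its image
in `R`, so `m * I = 0`. The canonical module is the injective hull `E` of the residue field. Its
submodule `(0 :_E I)` is the injective hull over the self-injective ring `R/I`, so it is cyclic,
generated by some `z` (`exists_span_eq_torsionBySet`). Since `I` kills `m E`, we get `m E ⊆ R z`;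
thus `E / R z` is a vector space over the residue field, and `1 ↦ z` gives the exact sequence.

Hulls are handled through simple socles. `exists_injective_isSocleGenerator` builds `E`, and
`injective_of_hasInjectiveDimensionLE` turns the Gorenstein hypothesis into self-injectivity. -/

namespace LocalAlgebra

open IsLocalRing

/-! ### Socles over Artinian local rings -/

section Socle

variable {R : Type u} [CommRing R] [IsLocalRing R]

/-- An element of a module over a local ring generating a simple socle. -/
structure IsSocleGenerator {M : Type u} [AddCommGroup M] [Module R M] (x : M) : Prop where
  ne_zero : x ≠ 0
  smul_eq_zero : ∀ r ∈ maximalIdeal R, r • x = 0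
  exists_smul_eq : ∀ y : M, (∀ r ∈ maximalIdeal R, r • y = 0) → ∃ a : R, y = a • x

variable {M N : Type u} [AddCommGroup M] [Module R M] [AddCommGroup N] [Module R N]

/-- The socle is essential: the maximal ideal `m` is nilpotent, so at the least `n` with `m ^ n y =
0`, any nonzero multiple of `y` by an element of `m ^ (n - 1)` works. -/
theorem exists_smul_mem_socle [IsArtinianRing R] {y : M} (hy : y ≠ 0) :
    ∃ a : R, a • y ≠ 0 ∧ ∀ r ∈ maximalIdeal R, r • a • y = 0 := by
  classical
  obtain ⟨n, hn⟩ := (isArtinianRing_iff_isNilpotent_maximalIdeal R).mp inferInstance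
  have hex : ∃ n, ∀ a ∈ maximalIdeal R ^ n, a • y = 0 :=
    ⟨n, fun a ha => by rw [hn] at ha; rw [(Submodule.mem_bot R).mp ha, zero_smul]⟩
  have hmin := fun m => Nat.find_min hex (m := m)
  have hspec := Nat.find_spec hex
  rcases hk : Nat.find hex with _ | k
  · rw [hk] at hspec
    exact absurd (by simpa using hspec 1 (by simp)) hy
  · have := hmin k (by omega)
    push Not at this
    obtain ⟨a, ha, hay⟩ := this
    refine ⟨a, hay, fun r hr => ?_⟩
    rw [smul_smul]
    refine hspec _ ?_
    rw [hk, pow_succ']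
    exact Ideal.mul_mem_mul hr ha

theorem isUnit_of_smul_ne_zero {x : M} (hx : ∀ r ∈ maximalIdeal R, r • x = 0) {a : R}
    (ha : a • x ≠ 0) : IsUnit a := by
  by_contra h
  exact ha (hx a h)

theorem smul_eq_zero_iff_mem_maximalIdeal {x : M} (hx0 : x ≠ 0)
    (hx : ∀ r ∈ maximalIdeal R, r • x = 0) {a : R} : a • x = 0 ↔ a ∈ maximalIdeal R := by
  refine ⟨fun h ha => hx0 ?_, hx a⟩
  have hu : IsUnit a := by simpa using ha
  rwa [hu.smul_eq_zero] at h

/-- A linear map is injective if it does not kill a generator of a simple essential socle. -/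
theorem IsSocleGenerator.injective [IsArtinianRing R] {x : M} (hx : IsSocleGenerator (R := R) x)
    (f : M →ₗ[R] N) (hf : f x ≠ 0) : Function.Injective f := by
  rw [← LinearMap.ker_eq_bot, LinearMap.ker_eq_bot']
  intro y hy
  by_contra hy0
  obtain ⟨a, ha, hsoc⟩ := exists_smul_mem_socle (R := R) hy0
  obtain ⟨b, hb⟩ := hx.exists_smul_eq _ hsoc
  have hu : IsUnit b := isUnit_of_smul_ne_zero hx.smul_eq_zero (hb ▸ ha)
  apply hf
  have : b • f x = 0 := by rw [← map_smul, ← hb, map_smul, hy, smul_zero]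
  rwa [hu.smul_eq_zero] at this

/-- Socle elements can be mapped to socle elements of injective modules. -/
theorem exists_linearMap_apply_eq {Q : Type u} [AddCommGroup Q] [Module R Q]
    [Module.Injective R Q] {x : M} (hx0 : x ≠ 0) (hx : ∀ r ∈ maximalIdeal R, r • x = 0)
    {y : Q} (hy : ∀ r ∈ maximalIdeal R, r • y = 0) : ∃ h : M →ₗ[R] Q, h x = y := by
  let f : (R ⧸ maximalIdeal R) →ₗ[R] M :=
    Submodule.liftQ _ (LinearMap.toSpanSingleton R M x) fun r hr => by simpa using hx r hr
  let g : (R ⧸ maximalIdeal R) →ₗ[R] Q :=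
    Submodule.liftQ _ (LinearMap.toSpanSingleton R Q y) fun r hr => by simpa using hy r hr
  have hf : Function.Injective f := by
    rw [← LinearMap.ker_eq_bot]
    refine Submodule.ker_liftQ_eq_bot _ _ _ fun r hr => ?_
    exact (smul_eq_zero_iff_mem_maximalIdeal hx0 hx).mp (by simpa using hr)
  obtain ⟨h, hh⟩ := Module.Injective.out f hf g
  refine ⟨h, ?_⟩
  have hf1 : f (Submodule.Quotient.mk 1) = x := by simp only [f, Submodule.liftQ_apply]; simp
  have hg1 : g (Submodule.Quotient.mk 1) = y := by simp only [g, Submodule.liftQ_apply]; simp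
  rw [← hf1, hh, hg1]

/-- By injectivity any socle element is the image of a fixed nonzero one under an endomorphism of
`R`, which is a multiplication. -/
theorem exists_isSocleGenerator_self [IsArtinianRing R] [Module.Injective R R] :
    ∃ e : R, IsSocleGenerator (R := R) e := by
  obtain ⟨a, ha, hsoc⟩ := exists_smul_mem_socle (R := R) (one_ne_zero (α := R))
  refine ⟨a • 1, ha, hsoc, fun y hy => ?_⟩
  obtain ⟨h, hh⟩ := exists_linearMap_apply_eq ha hsoc hy
  refine ⟨h 1, ?_⟩
  rw [← hh, map_smul, smul_eq_mul, smul_eq_mul, smul_eq_mul, mul_one, mul_comm]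

theorem mk_mem_maximalIdeal_iff (I : Ideal R) [IsLocalRing (R ⧸ I)] {r : R} :
    Ideal.Quotient.mk I r ∈ maximalIdeal (R ⧸ I) ↔ r ∈ maximalIdeal R := by
  have := IsLocalHom.of_surjective (Ideal.Quotient.mk I) Ideal.Quotient.mk_surjective
  simp [mem_nonunits_iff]

end Socle

/-! ### The `I`-torsion and the injective hull of the residue field -/

section Torsion

variable {R : Type u} [CommRing R] [IsLocalRing R] [IsArtinianRing R]

variable (I : Ideal R) [IsLocalRing (R ⧸ I)] [Module.Injective (R ⧸ I) (R ⧸ I)]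
  {X : Type u} [AddCommGroup X] [Module R X] {x : X}

include I in
-- The torsion is an `R ⧸ I`-module with the same simple socle as `X`; extend a nonzero map from
-- that socle to the injective module `R ⧸ I`.
theorem exists_injective_torsionBySet (hx : IsSocleGenerator (R := R) x) :
    ∃ h : Submodule.torsionBySet R X I →ₗ[R] R ⧸ I, Function.Injective h := by
  obtain ⟨e, he⟩ := exists_isSocleGenerator_self (R := R ⧸ I)
  have hI : I ≤ maximalIdeal R := le_maximalIdeal (Ideal.Quotient.nontrivial_iff.mp inferInstance)
  let t : Submodule.torsionBySet R X I :=
    ⟨x, (Submodule.mem_torsionBySet_iff _ _).mpr fun a => hx.smul_eq_zero _ (hI a.2)⟩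
  have ht : IsSocleGenerator (R := R ⧸ I) t := by
    refine ⟨fun h => hx.ne_zero (congrArg Subtype.val h), fun r hr => ?_, fun y hy => ?_⟩
    · obtain ⟨r, rfl⟩ := Ideal.Quotient.mk_surjective r
      rw [Submodule.torsionBySet.mk_smul]
      exact Subtype.ext (hx.smul_eq_zero _ ((mk_mem_maximalIdeal_iff I).mp hr))
    · obtain ⟨a, ha⟩ := hx.exists_smul_eq y fun r hr => by
        have := hy _ ((mk_mem_maximalIdeal_iff I).mpr hr)
        rw [Submodule.torsionBySet.mk_smul] at this
        exact congrArg Subtype.val this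
      exact ⟨Ideal.Quotient.mk I a, by rw [Submodule.torsionBySet.mk_smul]; exact Subtype.ext ha⟩
  obtain ⟨h, hh⟩ := exists_linearMap_apply_eq ht.ne_zero ht.smul_eq_zero he.smul_eq_zero
  exact ⟨h.restrictScalars R, ht.injective h (hh ▸ he.ne_zero)⟩

include I in
/-- Modules with a simple essential socle are finite, provided `R` is a small extension of
a self-injective ring. -/
theorem IsSocleGenerator.isNoetherian (hmI : maximalIdeal R * I = ⊥)
    (hx : IsSocleGenerator (R := R) x) : IsNoetherian R X := by
  obtain ⟨h, hh⟩ := exists_injective_torsionBySet I hx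
  have hT : IsNoetherian R (Submodule.torsionBySet R X I) := isNoetherian_of_injective h hh
  obtain ⟨n, s, hs⟩ := Submodule.fg_iff_exists_fin_generating_family.mp (IsNoetherian.noetherian I)
  have hsI (i) : s i ∈ I := hs ▸ Submodule.subset_span ⟨i, rfl⟩
  -- Generators of `I` send `X` into its socle because `m * I = ⊥`, so `φ` has Noetherian target,
  -- and its kernel is the `I`-torsion.
  let φ : X →ₗ[R] (Fin n → Submodule.span R {x}) := LinearMap.pi fun i =>
    (LinearMap.lsmul R X (s i)).codRestrict _ fun y => by
      obtain ⟨a, ha⟩ := hx.exists_smul_eq (s i • y) fun r hr => by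
        have : r * s i ∈ maximalIdeal R * I := Ideal.mul_mem_mul hr (hsI i)
        rw [hmI] at this
        rw [smul_smul, (Submodule.mem_bot R).mp this, zero_smul]
      exact Submodule.mem_span_singleton.mpr ⟨a, by simp [ha]⟩
  refine isNoetherian_of_range_eq_ker (Submodule.torsionBySet R X I).subtype φ ?_
  rw [Submodule.range_subtype]
  ext y
  have hker : y ∈ LinearMap.ker φ ↔ ∀ i, s i • y = 0 := by
    simp [φ, funext_iff, Subtype.ext_iff]
  rw [hker, ← hs, Ideal.submodule_span_eq, ← Submodule.torsionBySet_eq_torsionBySet_span]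
  simp [Submodule.mem_torsionBySet_iff]

/-- The torsion and `R ⧸ I` embed in each other; finite length makes the embeddings isomorphisms,
and `z` is the image of `1`. -/
theorem exists_span_eq_torsionBySet [Module.Injective R X] (hx : IsSocleGenerator (R := R) x) :
    ∃ z : X, Submodule.span R {z} = Submodule.torsionBySet R X I := by
  obtain ⟨e, he⟩ := exists_isSocleGenerator_self (R := R ⧸ I)
  have he' : IsSocleGenerator (R := R) e := by
    refine ⟨he.ne_zero, fun r hr => ?_, fun y hy => ?_⟩
    · exact he.smul_eq_zero _ ((mk_mem_maximalIdeal_iff I).mpr hr)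
    · obtain ⟨a, ha⟩ := he.exists_smul_eq y fun r hr => by
        obtain ⟨r, rfl⟩ := Ideal.Quotient.mk_surjective r
        exact hy r ((mk_mem_maximalIdeal_iff I).mp hr)
      obtain ⟨a, rfl⟩ := Ideal.Quotient.mk_surjective a
      exact ⟨a, ha⟩
  obtain ⟨h, hh⟩ := exists_injective_torsionBySet I hx
  obtain ⟨g, hg⟩ := exists_linearMap_apply_eq (R := R) he'.ne_zero he'.smul_eq_zero hx.smul_eq_zero
  have hgT (a) : g a ∈ Submodule.torsionBySet R X I := by
    refine (Submodule.mem_torsionBySet_iff _ _).mpr fun i => ?_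
    obtain ⟨a, rfl⟩ := Ideal.Quotient.mk_surjective a
    rw [← map_smul, Algebra.smul_def, Ideal.Quotient.algebraMap_eq,
      Ideal.Quotient.eq_zero_iff_mem.mpr i.2, zero_mul, map_zero]
  let g' : (R ⧸ I) →ₗ[R] Submodule.torsionBySet R X I := g.codRestrict _ hgT
  have hginj : Function.Injective g' := by
    have := he'.injective g (hg ▸ hx.ne_zero)
    exact fun a b hab => this (congrArg Subtype.val hab)
  have hsurj := IsArtinian.surjective_of_injective_endomorphism (h ∘ₗ g') (hh.comp hginj)
  refine ⟨g 1, le_antisymm ?_ fun y hy => ?_⟩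
  · rw [Submodule.span_singleton_le_iff_mem]
    exact hgT 1
  · obtain ⟨a, ha⟩ := hsurj (h ⟨y, hy⟩)
    obtain ⟨a, rfl⟩ := Ideal.Quotient.mk_surjective a
    refine Submodule.mem_span_singleton.mpr ⟨a, ?_⟩
    have := congrArg Subtype.val (hh ha)
    rw [← map_smul, Algebra.smul_def, Ideal.Quotient.algebraMap_eq, mul_one]
    exact this

include I in
/-- Existence of an injective hull of the residue field with finite underlying module. -/
theorem exists_injective_isSocleGenerator (hmI : maximalIdeal R * I = ⊥) :
    ∃ (X : Type u) (_ : AddCommGroup X) (_ : Module R X) (x : X),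
      IsSocleGenerator (R := R) x ∧ Module.Injective R X ∧ Module.Finite R X := by
  obtain ⟨⟨Q, hQ, f, hf⟩⟩ := EnoughInjectives.presentation (ModuleCat.of R (ResidueField R))
  have hf : Function.Injective f.hom := (ModuleCat.mono_iff_injective f).mp hf
  have : Module.Injective R Q := Module.injective_module_of_injective_object R Q
  obtain ⟨q, hq⟩ : ∃ q : Q, q = f.hom 1 := ⟨_, rfl⟩
  have hq0 : q ≠ 0 := by
    rw [hq, Ne, map_eq_zero_iff _ hf]
    exact one_ne_zero
  have hmq : ∀ r ∈ maximalIdeal R, r • q = 0 := fun r hr => by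
    have h0 : r • (1 : ResidueField R) = 0 := by
      rw [Algebra.smul_def, mul_one, ResidueField.algebraMap_eq, residue_eq_zero_iff]
      exact hr
    rw [hq, ← map_smul]
    erw [h0]
    exact map_zero _
  -- For `C` maximal avoiding `q`, every nonzero submodule of `Q ⧸ C` contains the class of `q`,
  -- which forces a simple socle.
  obtain ⟨C, -, hC⟩ := zorn_le_nonempty₀ {C : Submodule R Q | q ∉ C} (fun c hc hchain y hy => by
    refine ⟨sSup c, ?_, fun z hz => le_sSup hz⟩
    intro hmem
    obtain ⟨D, hD, hqD⟩ := (Submodule.mem_sSup_of_directed ⟨y, hy⟩ hchain.directedOn).mp hmem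
    exact hc hD hqD) ⊥ (by simpa using hq0)
  have hqC : q ∉ C := hC.prop
  let x : Q ⧸ C := C.mkQ q
  have hx : IsSocleGenerator (R := R) x := by
    have hx0 : x ≠ 0 := by simpa [x] using hqC
    have hmx : ∀ r ∈ maximalIdeal R, r • x = 0 := fun r hr => by
      rw [← map_smul, hmq r hr, map_zero]
    refine ⟨hx0, hmx, fun y hy => ?_⟩
    obtain ⟨y, rfl⟩ := C.mkQ_surjective y
    by_cases hyC : y ∈ C
    · exact ⟨0, by simpa using hyC⟩
    have : q ∈ C ⊔ Submodule.span R {y} := by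
      by_contra h
      have := hC.le_of_ge h le_sup_left
      exact hyC (this (le_sup_right (a := C) (Submodule.mem_span_singleton_self y)))
    obtain ⟨c, hc, d, hd, hcd⟩ := Submodule.mem_sup.mp this
    obtain ⟨b, rfl⟩ := Submodule.mem_span_singleton.mp hd
    have hxb : x = b • C.mkQ y := by
      rw [← map_smul]
      change C.mkQ q = _
      rw [← hcd, map_add, (Submodule.Quotient.mk_eq_zero C).mpr hc |> id (α := C.mkQ c = 0),
      zero_add]
    obtain ⟨u, rfl⟩ := isUnit_of_smul_ne_zero hy (hxb ▸ hx0)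
    exact ⟨(u⁻¹ : Rˣ), by rw [hxb, smul_smul, Units.inv_mul, one_smul]⟩
  have hN : IsNoetherian R (Q ⧸ C) := hx.isNoetherian I hmI
  obtain ⟨g, hg⟩ := exists_linearMap_apply_eq (R := R) hx.ne_zero hx.smul_eq_zero hmq
  have hinj : Function.Injective (C.mkQ ∘ₗ g) := hx.injective _ (by
    rw [LinearMap.comp_apply, hg]
    exact hx.ne_zero)
  -- `Q ⧸ C` has finite length, so this injective endomorphism is bijective; hence `Q ⧸ C` is a
  -- retract of `Q` and inherits injectivity.
  let e := LinearEquiv.ofBijective (C.mkQ ∘ₗ g) (IsArtinian.bijective_of_injective_endomorphism _ hinj)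
  refine ⟨Q ⧸ C, inferInstance, inferInstance, x, hx, ⟨fun Y Z _ _ _ _ i hi φ => ?_⟩, inferInstance⟩
  obtain ⟨ψ, hψ⟩ := Module.Injective.out i hi (g ∘ₗ φ)
  refine ⟨e.symm.toLinearMap ∘ₗ C.mkQ ∘ₗ ψ, fun y => ?_⟩
  simp only [LinearMap.comp_apply, hψ, LinearEquiv.coe_coe]
  exact e.symm_apply_apply (φ y)

end Torsion
-- Finite injective dimension over Artinian local rings
section FiniteInjectiveDimension

open Abelian

variable {A : Type u} [CommRing A] [IsLocalRing A] [IsArtinianRing A]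

/-- Over an Artinian local ring, semisimple modules embed in free modules. -/
theorem exists_injective_finsupp (V : Type u) [AddCommGroup V] [Module A V]
    (hV : Module.IsTorsionBySet A V (maximalIdeal A)) :
    ∃ (ι : Type u) (f : V →ₗ[A] ι →₀ A), Function.Injective f := by
  obtain ⟨a, ha, hsoc⟩ := exists_smul_mem_socle (R := A) (one_ne_zero (α := A))
  let : Module (ResidueField A) V := hV.module
  have : IsScalarTower A (ResidueField A) V := hV.isScalarTower
  let b := Module.Basis.ofVectorSpace (ResidueField A) V
  let g : ResidueField A →ₗ[A] A :=
    Submodule.liftQ (maximalIdeal A) (LinearMap.toSpanSingleton A A (a • 1))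
      fun r hr => by simpa using hsoc r hr
  have hg : Function.Injective g := by
    rw [← LinearMap.ker_eq_bot]
    refine Submodule.ker_liftQ_eq_bot _ _ _ fun r hr => ?_
    exact (smul_eq_zero_iff_mem_maximalIdeal ha hsoc).mp (by simpa using hr)
  refine ⟨_, Finsupp.mapRange.linearMap g ∘ₗ (b.repr.restrictScalars A).toLinearMap, ?_⟩
  rw [LinearMap.coe_comp]
  exact (Finsupp.mapRange_injective _ (map_zero g) hg).comp
    (b.repr.restrictScalars A).injective

/-- Embed `V` in a free module `F`: `Ext^d(V, Y)` sits between `Ext^d(F, Y) = 0` and `Ext^(d+1)(F/V,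
Y) = 0`. -/
theorem subsingleton_ext_of_isTorsionBySet (Y : ModuleCat.{u} A) (d : ℕ) (hd : d ≠ 0)
    [HasInjectiveDimensionLT Y (d + 1)] (V : Type u) [AddCommGroup V] [Module A V]
    (hV : Module.IsTorsionBySet A V (maximalIdeal A)) :
    Subsingleton (Ext (ModuleCat.of A V) Y d) := by
  obtain ⟨ι, f, hf⟩ := exists_injective_finsupp V hV
  let S : ShortComplex (ModuleCat.{u} A) :=
    ModuleCat.shortComplexOfCompEqZero _ _ f.exact_map_mkQ_range.linearMap_comp_eq_zero
  have hS : S.ShortExact := ModuleCat.shortComplex_shortExact S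
    f.exact_map_mkQ_range hf (Submodule.mkQ_surjective _)
  have hP : Projective S.X₂ :=
    inferInstanceAs (Projective (ModuleCat.of A (ι →₀ A)))
  refine subsingleton_of_forall_eq 0 fun e => ?_
  obtain ⟨x, hx⟩ := Ext.contravariant_sequence_exact₁ hS Y e (add_comm 1 d)
    (Ext.eq_zero_of_hasInjectiveDimensionLT _ (d + 1) le_rfl)
  obtain ⟨d, rfl⟩ := Nat.exists_eq_succ_of_ne_zero hd
  rw [← hx, Ext.eq_zero_of_projective x, Ext.comp_zero]

theorem subsingleton_ext_of_pow_smul (Y : ModuleCat.{u} A) (d : ℕ) (hd : d ≠ 0)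
    [HasInjectiveDimensionLT Y (d + 1)] (n : ℕ) (V : Type u) [AddCommGroup V] [Module A V]
    (hV : maximalIdeal A ^ n • (⊤ : Submodule A V) = ⊥) :
    Subsingleton (Ext (ModuleCat.of A V) Y d) := by
  induction n generalizing V with
  | zero =>
    refine subsingleton_ext_of_isTorsionBySet Y d hd V fun {x} r => ?_
    have : x ∈ (⊤ : Submodule A V) := trivial
    rw [pow_zero, Ideal.one_eq_top, Submodule.top_smul] at hV
    rw [hV, Submodule.mem_bot] at this
    rw [this, smul_zero]
  | succ n ih =>
    let W : Submodule A V := maximalIdeal A • ⊤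
    let S : ShortComplex (ModuleCat.{u} A) :=
      ModuleCat.shortComplexOfCompEqZero W.subtype W.mkQ (by ext; simp)
    have hS : S.ShortExact := ModuleCat.shortComplex_shortExact S
      (LinearMap.exact_subtype_mkQ W) W.subtype_injective W.mkQ_surjective
    have h1 : Subsingleton (Ext S.X₁ Y d) := by
      refine ih W ?_
      apply Submodule.map_injective_of_injective W.subtype_injective
      rw [Submodule.map_smul'', Submodule.map_top, Submodule.range_subtype, Submodule.map_bot,
        ← hV, pow_succ, Submodule.mul_smul]
    have h3 : Subsingleton (Ext S.X₃ Y d) :=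
      subsingleton_ext_of_isTorsionBySet Y d hd _
        (Module.isTorsionBySet_quotient_ideal_smul V (maximalIdeal A))
    refine subsingleton_of_forall_eq 0 fun e => ?_
    obtain ⟨x, rfl⟩ := Ext.contravariant_sequence_exact₂ hS Y e (Subsingleton.elim _ _)
    rw [Subsingleton.elim x 0, Ext.comp_zero]

/-- Over an Artinian local ring, modules of finite injective dimension are injective. -/
theorem injective_of_hasInjectiveDimensionLE (Y : ModuleCat.{u} A) (m : ℕ)
    (hY : HasInjectiveDimensionLE Y m) : Injective Y := by
  induction m with
  | zero => exact injective_iff_hasInjectiveDimensionLT_one.mpr hY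
  | succ m ih =>
    -- Dimension at most `m` means vanishing of `Ext^(m+1)(V, Y)`; filter `V` by powers of the
    -- nilpotent maximal ideal.
    refine ih (hasInjectiveDimensionLT_of_enoughProjectives Y (m + 1) fun V => ?_)
    obtain ⟨n, hn⟩ := (isArtinianRing_iff_isNilpotent_maximalIdeal A).mp inferInstance
    have : HasInjectiveDimensionLT Y (m + 1 + 1) := hY
    refine subsingleton_ext_of_pow_smul Y (m + 1) m.succ_ne_zero n V ?_
    rw [hn]
    exact Submodule.bot_smul _

end FiniteInjectiveDimension

/-! ### The canonical module and the exact sequence -/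

section Canonical

variable {R : Type u} [CommRing R] [IsLocalRing R]
  {X : Type u} [AddCommGroup X] [Module R X] {x : X}

theorem IsSocleGenerator.bassNumber_zero (hx : IsSocleGenerator (R := R) x) :
    bassNumber R X 0 = 1 := by
  let e : Abelian.Ext (ModuleCat.of R (ResidueField R)) (ModuleCat.of R X) 0 ≃ₗ[R]
      (ResidueField R →ₗ[R] X) :=
    Abelian.Ext.linearEquiv₀ ≪≫ₗ ModuleCat.homLinearEquiv
  let f : ResidueField R →ₗ[R] X :=
    Submodule.liftQ (maximalIdeal R) (LinearMap.toSpanSingleton R X x)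
      fun r hr => by simpa using hx.smul_eq_zero r hr
  have hf (r : R) : f (residue R r) = r • x := rfl
  let g : ResidueField R →ₗ[R] (ResidueField R →ₗ[R] X) :=
    Submodule.liftQ (maximalIdeal R) (LinearMap.toSpanSingleton R _ f)
      fun r hr => by
        rw [LinearMap.mem_ker, LinearMap.toSpanSingleton_apply]
        ext y
        obtain ⟨y, rfl⟩ := residue_surjective y
        rw [LinearMap.smul_apply, hf, smul_comm, hx.smul_eq_zero r hr, smul_zero]
        rfl
  have hg (r : R) : g (residue R r) = r • f := rfl
  have hgb : Function.Bijective g := by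
    constructor
    · rw [← LinearMap.ker_eq_bot]
      refine Submodule.ker_liftQ_eq_bot _ _ _ fun r hr => ?_
      rw [LinearMap.mem_ker, LinearMap.toSpanSingleton_apply] at hr
      have := LinearMap.congr_fun hr (residue R 1)
      rw [LinearMap.smul_apply, hf, one_smul] at this
      exact (smul_eq_zero_iff_mem_maximalIdeal hx.ne_zero hx.smul_eq_zero).mp this
    · intro φ
      obtain ⟨a, ha⟩ := hx.exists_smul_eq (φ 1) fun r hr => by
        have h0 : r • (1 : ResidueField R) = 0 := by
          rw [Algebra.smul_def, mul_one, ResidueField.algebraMap_eq, residue_eq_zero_iff]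
          exact hr
        rw [← map_smul, h0, map_zero]
      refine ⟨residue R a, ?_⟩
      rw [hg]
      ext y
      obtain ⟨y, rfl⟩ := residue_surjective y
      have : residue R y = y • (1 : ResidueField R) := by
        rw [Algebra.smul_def, mul_one, ResidueField.algebraMap_eq]
      rw [LinearMap.smul_apply, hf, this, map_smul, ha, smul_comm]
  rw [bassNumber, (e ≪≫ₗ (LinearEquiv.ofBijective g hgb).symm).length_eq,
    Module.length_eq_one_iff, isSimpleModule_iff_quot_maximal]
  exact ⟨maximalIdeal R, inferInstance, ⟨LinearEquiv.refl _ _⟩⟩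

theorem exists_exact_of_smul_le (z : X) [Module.Finite R X]
    (hz : ∀ r ∈ maximalIdeal R, ∀ y : X, r • y ∈ Submodule.span R {z}) :
    ∃ (n : ℕ) (f : R →ₗ[R] X) (g : X →ₗ[R] (Fin n → ResidueField R)),
      Function.Exact f g ∧ Function.Surjective g := by
  let T := Submodule.span R {z}
  have hT : Module.IsTorsionBySet R (X ⧸ T) (maximalIdeal R) := by
    rintro y ⟨r, hr⟩
    obtain ⟨y, rfl⟩ := T.mkQ_surjective y
    exact (Submodule.Quotient.mk_eq_zero T).mpr (hz r hr y)
  let : Module (ResidueField R) (X ⧸ T) := hT.module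
  have : IsScalarTower R (ResidueField R) (X ⧸ T) := hT.isScalarTower
  have : Module.Finite (ResidueField R) (X ⧸ T) :=
    Module.Finite.of_restrictScalars_finite R _ _
  let e := (Module.finBasis (ResidueField R) (X ⧸ T)).equivFun.restrictScalars R
  refine ⟨_, LinearMap.toSpanSingleton R X z, e.toLinearMap ∘ₗ T.mkQ, ?_,
    e.surjective.comp T.mkQ_surjective⟩
  rw [LinearMap.exact_iff, LinearEquiv.ker_comp, Submodule.ker_mkQ,
    LinearMap.range_toSpanSingleton]

variable [IsArtinianRing R]

theorem ringKrullDim_eq_zero_of_isLocalRing : ringKrullDim R = 0 :=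
  ringKrullDimZero_iff_ringKrullDim_eq_zero.mp inferInstance

/-- A nonzero socle element is killed by the first term of any nonempty sequence in the maximal
ideal. -/
theorem depth_eq_zero (M : Type u) [AddCommGroup M] [Module R M] : depth R M = 0 := by
  refine le_antisymm (iSup_le fun rs => iSup_le fun hrs => iSup_le fun hreg => ?_) zero_le
  cases rs with
  | nil => simp
  | cons r rs =>
    exfalso
    have := hreg.nontrivial
    obtain ⟨y, hy⟩ := exists_ne (0 : M)
    obtain ⟨a, ha, hsoc⟩ := exists_smul_mem_socle (R := R) hy
    have hr := ((RingTheory.Sequence.isRegular_cons_iff M r rs).mp hreg).1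
    refine ha (hr ?_)
    simpa using hsoc r (hrs r (by simp))

theorem isCohenMacaulay_of_isArtinianRing : IsCohenMacaulay R where
  isNoetherianRing := inferInstance
  depth_eq := by rw [depth_eq_zero, ringKrullDim_eq_zero_of_isLocalRing]; rfl

theorem IsSocleGenerator.isCanonicalModule [Module.Injective R X] [Module.Finite R X]
    (hx : IsSocleGenerator (R := R) x) : IsCanonicalModule R X where
  finite := inferInstance
  nontrivial := ⟨x, 0, hx.ne_zero⟩
  depth_eq := by rw [depth_eq_zero, ringKrullDim_eq_zero_of_isLocalRing]; rfl
  type_eq_one := ⟨0, by rw [depth_eq_zero]; rfl, hx.bassNumber_zero⟩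
  injectiveDimension_finite := by
    have : Injective (ModuleCat.of R X) := Module.injective_object_of_injective_module R X
    exact ⟨0, injective_iff_hasInjectiveDimensionLT_one.mp this⟩

theorem isWeaklyAlmostGorenstein_of_injective_quotient (I : Ideal R) [IsLocalRing (R ⧸ I)]
    [Module.Injective (R ⧸ I) (R ⧸ I)] (hmI : maximalIdeal R * I = ⊥) :
    IsWeaklyAlmostGorenstein R where
  isCohenMacaulay := isCohenMacaulay_of_isArtinianRing
  ringKrullDim_le_one := by
    rw [ringKrullDim_eq_zero_of_isLocalRing]
    exact zero_le_one
  exists_exact := by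
    obtain ⟨X, _, _, x, hx, _, _⟩ := exists_injective_isSocleGenerator I hmI
    obtain ⟨z, hz⟩ := exists_span_eq_torsionBySet I hx
    refine ⟨X, inferInstance, inferInstance, hx.isCanonicalModule,
      exists_exact_of_smul_le z fun r hr y => ?_⟩
    rw [hz, Submodule.mem_torsionBySet_iff]
    intro i
    have : r * i ∈ maximalIdeal R * I := Ideal.mul_mem_mul hr i.2
    rw [hmI] at this
    rw [smul_smul, mul_comm, (Submodule.mem_bot R).mp this, zero_smul]

end Canonical

/-! ### Passage to `S ⧸ J` -/

theorem IsGorensteinLocal.injective_self {A : Type u} [CommRing A] [IsArtinianRing A]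
    (h : IsGorensteinLocal A) : Module.Injective A A := by
  have := h.toIsLocalRing
  obtain ⟨m, hm⟩ := h.injectiveDimension_finite
  have := injective_of_hasInjectiveDimensionLE _ m hm
  exact Module.injective_module_of_injective_object A A

end LocalAlgebra

theorem corollary5p11 {S : Type u} [CommRing S] [IsLocalRing S] [IsNoetherianRing S]
    (I : Ideal S) (hI : I ≤ IsLocalRing.maximalIdeal S ^ 2)
    (hprim : I.IsPrimary) (hrad : I.radical = IsLocalRing.maximalIdeal S)
    (hGor : LocalAlgebra.IsGorensteinLocal (S ⧸ I))
    (J : Ideal S) (hnIJ : IsLocalRing.maximalIdeal S * I ≤ J) (hJI : J ≤ I) :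
    LocalAlgebra.IsWeaklyAlmostGorenstein (S ⧸ J) := by
  have : Nontrivial (S ⧸ J) :=
    Ideal.Quotient.nontrivial_iff.mpr fun h => hprim.1 (top_le_iff.mp (h ▸ hJI))
  have : IsLocalRing (S ⧸ J) :=
    IsLocalRing.of_surjective' (Ideal.Quotient.mk J) Ideal.Quotient.mk_surjective
  have hmap : IsLocalRing.maximalIdeal (S ⧸ J) =
      (IsLocalRing.maximalIdeal S).map (Ideal.Quotient.mk J) := by
    ext y
    obtain ⟨y, rfl⟩ := Ideal.Quotient.mk_surjective y
    rw [LocalAlgebra.mk_mem_maximalIdeal_iff, Ideal.mem_quotient_iff_mem]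
    exact IsLocalRing.le_maximalIdeal (Ideal.Quotient.nontrivial_iff.mp inferInstance)
  have hmI : IsLocalRing.maximalIdeal (S ⧸ J) * I.map (Ideal.Quotient.mk J) = ⊥ := by
    rw [hmap, ← Ideal.map_mul, Ideal.map_eq_bot_iff_le_ker, Ideal.mk_ker]
    exact hnIJ
  have : IsArtinianRing (S ⧸ J) := by
    rw [isArtinianRing_iff_isNilpotent_maximalIdeal]
    obtain ⟨n, hn⟩ := I.exists_radical_pow_le_of_fg (IsNoetherian.noetherian _)
    -- The extra power is needed because `𝔫 ^ n ≤ I` only yields `𝔫 ^ (n + 1) ≤ 𝔫 * I ≤ J`.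
    refine ⟨n + 1, ?_⟩
    rw [Ideal.zero_eq_bot, hmap, ← Ideal.map_pow, Ideal.map_eq_bot_iff_le_ker, Ideal.mk_ker,
      pow_succ']
    exact (Ideal.mul_mono_right (hrad ▸ hn)).trans hnIJ
  let e := DoubleQuot.quotQuotEquivQuotOfLE hJI
  have := hGor.toIsLocalRing
  have : IsLocalRing ((S ⧸ J) ⧸ I.map (Ideal.Quotient.mk J)) := e.symm.isLocalRing
  have : IsArtinianRing (S ⧸ I) := e.isArtinianRing
  have := hGor.injective_self
  have : Module.Injective ((S ⧸ J) ⧸ I.map (Ideal.Quotient.mk J))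
      ((S ⧸ J) ⧸ I.map (Ideal.Quotient.mk J)) :=
    Module.Injective.of_ringEquiv e.symm e.symm.toSemilinearEquiv
  exact LocalAlgebra.isWeaklyAlmostGorenstein_of_injective_quotient _ hmI
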